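/- Let $q,t$ be real numbers with $|q|<t<1$ (so $q\in(-1,1)$), and put $[n]_{q,t}=\sum_{i=1}^{n}q^{i-1}t^{n-i}$ (with $0^0=1$). Let $H$ be a complex Hilbert space, with inner product linear in the second argument, and let $\mathcal F_{\rm fin}(H)=\bigoplus_{n\ge 0}H^{\otimes n}$ be the algebraic full Fock space, with vacuum vector $\Omega$ spanning $H^{\otimes 0}=\mathbb C\Omega$. The $(q,t)$-inner product on $\mathcal F_{\rm fin}(H)$ is the sesquilinear form for which $H^{\otimes m}\perp H^{\otimes n}$ for $m\ne n$ and $$\langle x_1\otimes\cdots\otimes x_n,\,y_1\otimes\cdots\otimes y_n\rangle_{q,t}=t^{\binom n2}\sum_{\sigma\in S(n)}\Big(\frac qt\Big)^{|\sigma|}\prod_{i=1}^n\langle x_i,y_{\sigma(i)}\rangle ,$$ where $|\sigma|$ is the number of inversions of $\sigma$. The vacuum state is $\tilde\varphi(X)=\langle\Omega,X\Omega\rangle_{q,t}$ for linear operators $X$ on $\mathcal F_{\rm fin}(H)$. For $x\in H$ and a bounded operator $T$ on $H$ define linear operators on $\mathcal F_{\rm fin}(H)$ by $a_{q,t}(x)\Omega=0$,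 $a^*_{q,t}(x)\Omega=x$, $\tilde p(T)\Omega=0$ and, for $n\ge1$, $$a_{q,t}(x)(x_1\otimes\cdots\otimes x_n)=\sum_{k=1}^n t^{k-1}q^{n-k}\langle x,x_k\rangle\,x_1\otimes\cdots\otimes\check x_k\otimes\cdots\otimes x_n,$$ $$a^*_{q,t}(x)(x_1\otimes\cdots\otimes x_n)=x_1\otimes\cdots\otimes x_n\otimes x,$$ $$\tilde p(T)(x_1\otimes\cdots\otimes x_n)=\sum_{k=1}^n t^{k-1}q^{n-k}\,x_1\otimes\cdots\otimes\check x_k\otimes\cdots\otimes x_n\otimes T x_k ,$$ where $\check x_k$ means that $x_k$ is omitted. Let $(T_x)_{x\in H}$ be a family of bounded operators on $H$ and put $\mathrm Y_{q,t}(x)=a_{q,t}(x)+a^*_{q,t}(x)+\tilde p(T_x)$. Let $\tilde P_n$ be the $(q,t)$-Poisson polynomials, defined by $\tilde P_0(y)=1$, $\tilde P_1(y)=y$ and $$y\tilde P_n(y)=\tilde P_{n+1}(y)+[n]_{q,t}\tilde P_n(y)+[n]_{q,t}\tilde P_{n-1}(y),\qquad n\ge1 .$$ Suppose that $x\in H$,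 $\|x\|=1$ and $T_x=\mathrm{Id}$. Then there is a probability measure $\tilde\mu_{q,t}$ on $\mathbb R$ such that (i) $\tilde\mu_{q,t}$ is the unique probability measure on $\mathbb R$ with finite moments of all orders for which the polynomials $(\tilde P_n)_{n\ge0}$ are pairwise orthogonal, and (ii) $\tilde\mu_{q,t}$ is the probability distribution of $\mathrm Y_{q,t}(x)$ with respect to the vacuum state, that is, the unique compactly supported probability measure $\mu$ on $\mathbb R$ with $\tilde\varphi\big(\mathrm Y_{q,t}(x)^n\big)=\int_{\mathbb R}y^n\,d\mu(y)$ for all $n\ge0$. -/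

import Mathlib

open scoped TensorProduct

noncomputable section

namespace QTFock

variable {H : Type*} [NormedAddCommGroup H] [InnerProductSpace ℂ H]

/-! ### The algebraic full Fock space and its inner products -/

/-- The algebraic full Fock space: the direct sum of the algebraic tensor powers of `H`. -/
abbrev Fock (H : Type*) [NormedAddCommGroup H] [InnerProductSpace ℂ H] : Type _ :=
  DirectSum ℕ (fun n : ℕ => ⨂[ℂ] _ : Fin n, H)

/-- The simple tensor `x 0 ⊗ ⋯ ⊗ x (n - 1)`, as an element of the Fock space. -/
def pureTensor {n : ℕ} (x : Fin n → H) : Fock H :=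
  DirectSum.lof ℂ ℕ (fun n : ℕ => ⨂[ℂ] _ : Fin n, H) n (PiTensorProduct.tprod ℂ x)

/-- The vacuum vector `Ω`, the unit of the zeroth tensor power. -/
def vacuum (H : Type*) [NormedAddCommGroup H] [InnerProductSpace ℂ H] : Fock H :=
  pureTensor (n := 0) (fun i => i.elim0)

/-- The linear functional `x 0 ⊗ ⋯ ⊗ x (n - 1) ↦ ∏ i, ⟪y i, x i⟫`. -/
def tensorFunctional {n : ℕ} (y : Fin n → H) : (⨂[ℂ] _ : Fin n, H) →ₗ[ℂ] ℂ :=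
  PiTensorProduct.lift ((MultilinearMap.mkPiAlgebra ℂ (Fin n) ℂ).compLinearMap
    (fun i => innerₛₗ ℂ (y i)))

theorem tensorFunctional_tprod {n : ℕ} (y x : Fin n → H) :
    tensorFunctional y (PiTensorProduct.tprod ℂ x) = ∏ i, inner ℂ (y i) (x i) := by
  simp [tensorFunctional]

theorem tensorFunctional_update_add {n : ℕ} [DecidableEq (Fin n)] (y : Fin n → H) (i : Fin n)
    (a b : H) :
    tensorFunctional (Function.update y i (a + b)) =
      tensorFunctional (Function.update y i a) + tensorFunctional (Function.update y i b) := by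
  refine PiTensorProduct.ext (MultilinearMap.ext fun x => ?_)
  have h := ((MultilinearMap.mkPiAlgebra ℂ (Fin n) ℂ).compLinearMap
    (fun i => innerₛₗ ℂ (x i))).map_update_add y i a b
  have h2 := congrArg (starRingEnd ℂ) h
  simp only [MultilinearMap.compLinearMap_apply, MultilinearMap.mkPiAlgebra_apply, map_add,
    map_prod, innerₛₗ_apply_apply, inner_conj_symm] at h2
  simpa only [LinearMap.compMultilinearMap_apply, LinearMap.add_apply, tensorFunctional_tprod]
    using h2

theorem tensorFunctional_update_smul {n : ℕ} [DecidableEq (Fin n)] (y : Fin n → H) (i : Fin n)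
    (c : ℂ) (a : H) :
    tensorFunctional (Function.update y i (c • a)) =
      (starRingEnd ℂ) c • tensorFunctional (Function.update y i a) := by
  refine PiTensorProduct.ext (MultilinearMap.ext fun x => ?_)
  have h := ((MultilinearMap.mkPiAlgebra ℂ (Fin n) ℂ).compLinearMap
    (fun i => innerₛₗ ℂ (x i))).map_update_smul y i c a
  have h2 := congrArg (starRingEnd ℂ) h
  simp only [MultilinearMap.compLinearMap_apply, MultilinearMap.mkPiAlgebra_apply, smul_eq_mul,
    map_mul, map_prod, innerₛₗ_apply_apply, inner_conj_symm] at h2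
  simpa only [LinearMap.compMultilinearMap_apply, LinearMap.smul_apply, smul_eq_mul,
    tensorFunctional_tprod] using h2

/-- The standard inner product on the `n`-th tensor power, linear in the *first* argument of this
map and antilinear in the second one. -/
def freeInnerFlip (n : ℕ) :
    (⨂[ℂ] _ : Fin n, H) →ₗ[ℂ] (⨂[ℂ] _ : Fin n, H) →ₛₗ[starRingEnd ℂ] ℂ :=
  PiTensorProduct.lift
    { toFun := fun y =>
        { toFun := fun u => (starRingEnd ℂ) (tensorFunctional y u)
          map_add' := fun u v => by simp only [map_add]
          map_smul' := fun c u => by simp only [map_smul, smul_eq_mul, map_mul] }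
      map_update_add' := fun y i a b => by
        ext u
        simp only [tensorFunctional_update_add, LinearMap.add_apply, map_add, LinearMap.coe_mk,
          AddHom.coe_mk]
      map_update_smul' := fun y i c a => by
        ext u
        simp only [tensorFunctional_update_smul, LinearMap.smul_apply, smul_eq_mul, map_mul,
          RingHomCompTriple.comp_apply, RingHom.id_apply, LinearMap.coe_mk, AddHom.coe_mk] }

/-- The standard inner product on the `n`-th tensor power, antilinear in the first argument and
linear in the second one. -/
def freeInner (n : ℕ) :
    (⨂[ℂ] _ : Fin n, H) →ₛₗ[starRingEnd ℂ] (⨂[ℂ] _ : Fin n, H) →ₗ[ℂ] ℂ :=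
  (freeInnerFlip n).flip

theorem freeInner_tprod {n : ℕ} (x y : Fin n → H) :
    freeInner n (PiTensorProduct.tprod ℂ x) (PiTensorProduct.tprod ℂ y)
      = ∏ i, inner ℂ (x i) (y i) := by
  simp [freeInner, freeInnerFlip, tensorFunctional_tprod]

/-- The number of inversions of a permutation. -/
def inversions {n : ℕ} (σ : Equiv.Perm (Fin n)) : ℕ :=
  (Finset.univ.filter (fun p : Fin n × Fin n => p.1 < p.2 ∧ σ p.2 < σ p.1)).card

/-- The `(q,t)`-symmetrization operator `t ^ (n choose 2) * ∑ σ, (q / t) ^ |σ| σ`. -/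
def symmetrization (q t : ℝ) (n : ℕ) : (⨂[ℂ] _ : Fin n, H) →ₗ[ℂ] (⨂[ℂ] _ : Fin n, H) :=
  ((t : ℂ) ^ n.choose 2) • ∑ σ : Equiv.Perm (Fin n),
    (((q / t : ℝ) : ℂ) ^ inversions σ) •
      (PiTensorProduct.reindex ℂ (fun _ : Fin n => H) σ).toLinearMap

/-- The `(q,t)`-inner product on the Fock space: `⟪u, v⟫ = ∑ n, ⟪u n, P n (v n)⟫`, where `P n` is
the `(q,t)`-symmetrization operator. -/
def qtInner (q t : ℝ) (u v : Fock H) : ℂ :=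
  DirectSum.toModule ℂ ℕ ℂ (fun n => (freeInner n (u n)) ∘ₗ symmetrization q t n) v

theorem qtInner_pureTensor (q t : ℝ) {n : ℕ} (x y : Fin n → H) :
    qtInner q t (pureTensor x) (pureTensor y)
      = (t : ℂ) ^ n.choose 2 * ∑ σ : Equiv.Perm (Fin n),
          ((q / t : ℝ) : ℂ) ^ inversions σ * ∏ i, inner ℂ (x i) (y (σ.symm i)) := by
  simp [qtInner, pureTensor, symmetrization, DirectSum.lof_apply, PiTensorProduct.reindex_tprod,
    freeInner_tprod]

theorem qtInner_pureTensor_of_ne (q t : ℝ) {m n : ℕ} (h : m ≠ n) (x : Fin m → H)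
    (y : Fin n → H) : qtInner q t (pureTensor x) (pureTensor y) = 0 := by
  rw [qtInner, pureTensor, pureTensor, DirectSum.toModule_lof, DirectSum.lof_eq_of,
    DirectSum.of_eq_of_ne _ _ _ h.symm]
  simp

/-- The vacuum state `X ↦ ⟪Ω, X Ω⟫`. -/
def vacuumState (q t : ℝ) (X : Module.End ℂ (Fock H)) : ℂ :=
  qtInner q t (vacuum H) (X (vacuum H))

/-! ### Creation, annihilation and gauge operators -/

/-- The creation operator, on the `n`-th tensor power. -/
def creationAux (x : H) (n : ℕ) : (⨂[ℂ] _ : Fin n, H) →ₗ[ℂ] (⨂[ℂ] _ : Fin (n + 1), H) :=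
  PiTensorProduct.lift (MultilinearMap.curryMid (Fin.last n)
    (PiTensorProduct.tprod ℂ (s := fun _ : Fin (n + 1) => H)) x)

/-- The annihilation operator, on the `(n + 1)`-st tensor power. -/
def annihilationAux (q t : ℝ) (x : H) (n : ℕ) :
    (⨂[ℂ] _ : Fin (n + 1), H) →ₗ[ℂ] (⨂[ℂ] _ : Fin n, H) :=
  PiTensorProduct.lift (∑ k : Fin (n + 1), ((t : ℂ) ^ (k : ℕ) * (q : ℂ) ^ (n - (k : ℕ))) •
    LinearMap.uncurryMid k ((innerₛₗ ℂ x).smulRight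
      (PiTensorProduct.tprod ℂ (s := fun _ : Fin n => H))))

/-- The gauge operator, on the `(n + 1)`-st tensor power. -/
def gaugeAux (q t : ℝ) (T : H →L[ℂ] H) (n : ℕ) :
    (⨂[ℂ] _ : Fin (n + 1), H) →ₗ[ℂ] (⨂[ℂ] _ : Fin (n + 1), H) :=
  PiTensorProduct.lift (∑ k : Fin (n + 1), ((t : ℂ) ^ (k : ℕ) * (q : ℂ) ^ (n - (k : ℕ))) •
    LinearMap.uncurryMid k ((MultilinearMap.curryMid (Fin.last n)
      (PiTensorProduct.tprod ℂ (s := fun _ : Fin (n + 1) => H))) ∘ₗ T.toLinearMap))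

/-- The creation operator `x₁ ⊗ ⋯ ⊗ xₙ ↦ x₁ ⊗ ⋯ ⊗ xₙ ⊗ x`. -/
def creation (x : H) : Module.End ℂ (Fock H) :=
  DirectSum.toModule ℂ ℕ (Fock H) (fun n =>
    DirectSum.lof ℂ ℕ (fun n : ℕ => ⨂[ℂ] _ : Fin n, H) (n + 1) ∘ₗ creationAux x n)

/-- The `(q,t)`-annihilation operator. -/
def annihilation (q t : ℝ) (x : H) : Module.End ℂ (Fock H) :=
  DirectSum.toModule ℂ ℕ (Fock H) (fun n =>
    match n with
    | 0 => 0
    | n + 1 => DirectSum.lof ℂ ℕ (fun n : ℕ => ⨂[ℂ] _ : Fin n, H) n ∘ₗ annihilationAux q t x n)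

/-- The `(q,t)`-gauge operator of `T`. -/
def gauge (q t : ℝ) (T : H →L[ℂ] H) : Module.End ℂ (Fock H) :=
  DirectSum.toModule ℂ ℕ (Fock H) (fun n =>
    match n with
    | 0 => 0
    | n + 1 => DirectSum.lof ℂ ℕ (fun n : ℕ => ⨂[ℂ] _ : Fin n, H) (n + 1) ∘ₗ gaugeAux q t T n)

theorem creation_pureTensor (x : H) {n : ℕ} (v : Fin n → H) :
    creation x (pureTensor v) = pureTensor (Fin.snoc (α := fun _ => H) v x) := by
  simp [creation, pureTensor, creationAux, Fin.insertNth_last']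

theorem annihilation_vacuum (q t : ℝ) (x : H) : annihilation q t x (vacuum H) = 0 := by
  simp [annihilation, vacuum, pureTensor]

theorem annihilation_pureTensor (q t : ℝ) (x : H) {n : ℕ} (v : Fin (n + 1) → H) :
    annihilation q t x (pureTensor v) =
      ∑ k : Fin (n + 1), ((t : ℂ) ^ (k : ℕ) * (q : ℂ) ^ (n - (k : ℕ)) * inner ℂ x (v k)) •
        pureTensor (k.removeNth v) := by
  simp [annihilation, pureTensor, annihilationAux, smul_smul]

theorem gauge_vacuum (q t : ℝ) (T : H →L[ℂ] H) : gauge q t T (vacuum H) = 0 := by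
  simp [gauge, vacuum, pureTensor]

theorem gauge_pureTensor (q t : ℝ) (T : H →L[ℂ] H) {n : ℕ} (v : Fin (n + 1) → H) :
    gauge q t T (pureTensor v) =
      ∑ k : Fin (n + 1), ((t : ℂ) ^ (k : ℕ) * (q : ℂ) ^ (n - (k : ℕ))) •
        pureTensor (Fin.snoc (α := fun _ => H) (k.removeNth v) (T (v k))) := by
  simp [gauge, pureTensor, gaugeAux, Fin.insertNth_last']

/-- The operator `Y(x) = a(x) + a*(x) + p(T x)`, for a family `T` of operators on `H` indexed by
the vectors of `H`. -/
def fieldOp (q t : ℝ) (T : H → (H →L[ℂ] H)) (x : H) : Module.End ℂ (Fock H) :=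
  annihilation q t x + creation x + gauge q t (T x)

/-! ### Distributions and orthogonal polynomials -/

/-- `μ` is the probability distribution of `X` with respect to the state `φ`: the compactly
supported probability measure on the real line whose moments are the moments of `X`. -/
structure IsDistribution {A : Type*} [Monoid A] (φ : A → ℂ) (X : A)
    (μ : MeasureTheory.Measure ℝ) : Prop where
  isProbabilityMeasure : MeasureTheory.IsProbabilityMeasure μ
  compact_support : ∃ K : Set ℝ, IsCompact K ∧ μ Kᶜ = 0
  moment_eq : ∀ n : ℕ, φ (X ^ n) = ((∫ y, y ^ n ∂μ : ℝ) : ℂ)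

/-- `μ` is a probability measure with finite moments of all orders that makes the sequence of
polynomials `P` orthogonal. -/
structure IsOrthogonalityMeasure (P : ℕ → Polynomial ℝ) (μ : MeasureTheory.Measure ℝ) : Prop where
  isProbabilityMeasure : MeasureTheory.IsProbabilityMeasure μ
  integrable_pow : ∀ n : ℕ, MeasureTheory.Integrable (fun y : ℝ => y ^ n) μ
  orthogonal : ∀ m n : ℕ, m ≠ n → ∫ y, (P m).eval y * (P n).eval y ∂μ = 0

/-- The `(q,t)`-integer `[n] = ∑_{i=1}^n q^(i-1) t^(n-i)`. -/
def qtNumber (q t : ℝ) (n : ℕ) : ℝ :=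
  ∑ i ∈ Finset.Icc 1 n, q ^ (i - 1) * t ^ (n - i)

/-- The monic `(q,t)`-Poisson polynomials: `P₀ = 1`, `P₁ = y` and
`y Pₙ = Pₙ₊₁ + [n] Pₙ + [n] Pₙ₋₁` for `n ≥ 1`. -/
def poissonPoly (q t : ℝ) : ℕ → Polynomial ℝ
  | 0 => 1
  | 1 => Polynomial.X
  | n + 2 => Polynomial.X * poissonPoly q t (n + 1)
      - Polynomial.C (qtNumber q t (n + 1)) * poissonPoly q t (n + 1)
      - Polynomial.C (qtNumber q t (n + 1)) * poissonPoly q t n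

end QTFock

end

noncomputable section

namespace QTFock

open MeasureTheory Polynomial
open scoped CompactlySupported

/-! ### The `(q,t)`-integers -/

/-! When `T x = Id` and `‖x‖ = 1`, the field operator preserves the span of the vectors `x^{⊗n}` and
acts on them by the recursion of the Poisson polynomials (`fieldOp_pureTensor_const`). Hence `Pₙ(Y)Ω
= x^{⊗n}`, so the vacuum functional is 1 on `P₀` and 0 on every later `Pₙ`. The `Pₙ` span all
polynomials, so these values force it to be integration against any orthogonality measure
(`linearMap_eq_integral`). Neither positivity of the `(q,t)`-form nor symmetry of `Y` enters.

Existence is the easy direction of Favard's theorem: since `0 < [n+1]` and `[n] ≤ 1/(1-t)`, the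
Jacobi matrix with diagonal `[n]` and off-diagonal `√[n+1]` is a bounded self-adjoint operator on
`ℓ²`, and its spectral measure at the first basis vector is compactly supported and orthogonalizes
the `Pₙ`.

Both uniqueness claims follow from `measure_eq_of_moments_eq`, where only one of the two measures
needs compact support. -/

theorem qtNumber_zero (q t : ℝ) : qtNumber q t 0 = 0 := by simp [qtNumber]

theorem qtNumber_succ (q t : ℝ) (n : ℕ) : qtNumber q t (n + 1) = t * qtNumber q t n + q ^ n := by
  rw [qtNumber, Finset.sum_Icc_succ_top (by omega), qtNumber, Finset.mul_sum]
  congr 1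
  · refine Finset.sum_congr rfl fun i hi => ?_
    have := (Finset.mem_Icc.1 hi).2
    rw [Nat.succ_sub this, pow_succ]
    ring
  · simp

theorem qtNumber_mul_sub (q t : ℝ) (n : ℕ) : qtNumber q t n * (t - q) = t ^ n - q ^ n := by
  induction n with
  | zero => simp [qtNumber_zero]
  | succ n ih => rw [qtNumber_succ, add_mul, mul_assoc, ih]; ring

/-- For negative `q` the summands alternate in sign, so positivity is read off from `[n](t - q) = tⁿ
- qⁿ`. -/
theorem qtNumber_pos {q t : ℝ} (h : |q| < t) (n : ℕ) : 0 < qtNumber q t (n + 1) := by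
  have h1 : 0 < t - q := sub_pos.2 ((le_abs_self q).trans_lt h)
  refine pos_of_mul_pos_left ?_ h1.le
  rw [qtNumber_mul_sub, sub_pos]
  calc q ^ (n + 1) ≤ |q| ^ (n + 1) := (le_abs_self _).trans (abs_pow q _).le
    _ < t ^ (n + 1) := pow_lt_pow_left₀ h (abs_nonneg q) (by omega)

/-- `(1 - t)⁻¹` is the fixed point of `c ↦ t c + 1`, which dominates the recursion `[n+1] = t[n] +
qⁿ`. -/
theorem abs_qtNumber_le {q t : ℝ} (h : |q| < t) (ht : t < 1) (n : ℕ) :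
    |qtNumber q t n| ≤ (1 - t)⁻¹ := by
  have h1 : 0 < 1 - t := sub_pos.2 ht
  have h0 : 0 ≤ t := (abs_nonneg q).trans h.le
  induction n with
  | zero => simpa [qtNumber_zero] using ht.le
  | succ n ih =>
    calc |qtNumber q t (n + 1)| ≤ |t * qtNumber q t n| + |q ^ n| := by
          rw [qtNumber_succ]; exact abs_add_le _ _
      _ ≤ t * (1 - t)⁻¹ + 1 := by
          rw [abs_mul, abs_of_nonneg h0, abs_pow]
          gcongr
          exact pow_le_one₀ (abs_nonneg q) (h.trans ht).le
      _ = (1 - t)⁻¹ := by field_simp; ring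

theorem qtNumber_succ_eq_sum_fin (q t : ℝ) (n : ℕ) :
    qtNumber q t (n + 1) = ∑ k : Fin (n + 1), t ^ (k : ℕ) * q ^ (n - (k : ℕ)) := by
  induction n with
  | zero => simp [qtNumber]
  | succ n ih =>
    rw [qtNumber_succ, ih, Finset.mul_sum, Fin.sum_univ_succ (n := n + 1), add_comm]
    simp [pow_succ', mul_assoc]

/-! ### The `(q,t)`-Poisson polynomials -/

theorem X_mul_poissonPoly_succ (q t : ℝ) (n : ℕ) :
    X * poissonPoly q t (n + 1) = poissonPoly q t (n + 2)
      + C (qtNumber q t (n + 1)) * poissonPoly q t (n + 1)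
      + C (qtNumber q t (n + 1)) * poissonPoly q t n := by
  rw [poissonPoly]; ring

/-- By the recursion the span is stable under multiplication by `X`, and it contains 1; no degree
count is needed. -/
theorem span_range_poissonPoly (q t : ℝ) :
    Submodule.span ℝ (Set.range (poissonPoly q t)) = ⊤ := by
  have hX : ∀ p ∈ Submodule.span ℝ (Set.range (poissonPoly q t)),
      X * p ∈ Submodule.span ℝ (Set.range (poissonPoly q t)) := by
    intro p hp
    induction hp using Submodule.span_induction with
    | mem p hp =>
      obtain ⟨n, rfl⟩ := hp
      cases n with
      | zero => exact Submodule.subset_span ⟨1, by simp [poissonPoly]⟩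
      | succ n =>
        rw [X_mul_poissonPoly_succ, ← smul_eq_C_mul, ← smul_eq_C_mul]
        exact add_mem (add_mem (Submodule.subset_span ⟨_, rfl⟩)
          (Submodule.smul_mem _ _ (Submodule.subset_span ⟨_, rfl⟩)))
          (Submodule.smul_mem _ _ (Submodule.subset_span ⟨_, rfl⟩))
    | zero => simp
    | add p r _ _ hp hr => rw [mul_add]; exact add_mem hp hr
    | smul c p _ hp => rw [mul_smul_comm]; exact Submodule.smul_mem _ _ hp
  refine eq_top_iff.2 fun p _ => ?_
  induction p using Polynomial.induction_on with
  | C a =>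
    rw [← mul_one (C a), ← smul_eq_C_mul]
    exact Submodule.smul_mem _ _ (Submodule.subset_span ⟨0, by simp [poissonPoly]⟩)
  | add p r hp hr => exact add_mem (hp trivial) (hr trivial)
  | monomial n a h =>
    have := hX _ (h trivial)
    rwa [mul_left_comm, ← pow_succ'] at this

theorem linearMap_ext_poissonPoly {M : Type*} [AddCommGroup M] [Module ℝ M] (q t : ℝ)
    {f g : ℝ[X] →ₗ[ℝ] M} (h : ∀ n, f (poissonPoly q t n) = g (poissonPoly q t n)) : f = g :=
  LinearMap.ext_on_range (span_range_poissonPoly q t) h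

/-- An operator acting on a sequence of vectors by the recursion of the Poisson polynomials
sends the first vector to the `n`-th one under the `n`-th polynomial. -/
theorem aeval_poissonPoly_apply {M : Type*} [AddCommGroup M] [Module ℂ M] (q t : ℝ)
    (B : Module.End ℂ M) (v : ℕ → M) (h0 : B (v 0) = v 1)
    (h : ∀ n, B (v (n + 1)) = v (n + 2) + (qtNumber q t (n + 1) : ℂ) • v (n + 1)
      + (qtNumber q t (n + 1) : ℂ) • v n) (n : ℕ) :
    aeval B ((poissonPoly q t n).map (algebraMap ℝ ℂ)) (v 0) = v n := by
  induction n using Nat.twoStepInduction with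
  | zero => simp [poissonPoly]
  | one => simp [poissonPoly, h0]
  | more n ih1 ih2 =>
    simp only [poissonPoly, Polynomial.map_sub, Polynomial.map_mul, map_X, map_C, map_sub, map_mul,
      aeval_X, aeval_C, LinearMap.sub_apply, Module.End.mul_apply, ih1, ih2, h,
      Module.algebraMap_end_apply, Complex.coe_algebraMap]
    abel

/-! ### Spectral measures and moments -/

/-- The functional `f ↦ Re ⟪e, f(A) e⟫` on continuous functions on the spectrum is positive, so
Riesz–Markov represents it by a measure there, which is pushed forward to the line. -/
theorem exists_spectral_measure {E : Type*} [NormedAddCommGroup E] [InnerProductSpace ℂ E]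
    [CompleteSpace E] (A : E →L[ℂ] E) (hA : IsSelfAdjoint A) (e : E) :
    ∃ μ : Measure ℝ, IsFiniteMeasure μ ∧ (∃ K : Set ℝ, IsCompact K ∧ μ Kᶜ = 0) ∧
      ∀ p : ℝ[X], ∫ y, p.eval y ∂μ = (inner ℂ e (aeval A p e)).re := by
  let Λ₀ : C_c(spectrum ℝ A, ℝ) →ₗ[ℝ] ℝ :=
    { toFun := fun f => (inner ℂ e (cfcHom hA (f : C(spectrum ℝ A, ℝ)) e)).re
      map_add' := fun f g => by
        have : ((f + g : C_c(spectrum ℝ A, ℝ)) : C(spectrum ℝ A, ℝ)) = f + g := rfl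
        simp [this, map_add]
      map_smul' := fun c f => by
        have : ((c • f : C_c(spectrum ℝ A, ℝ)) : C(spectrum ℝ A, ℝ)) = c • (f : C(_, _)) := rfl
        rw [this, map_smul, smul_apply, inner_smul_right_eq_smul]
        simp }
  let Λ : C_c(spectrum ℝ A, ℝ) →ₚ[ℝ] ℝ := PositiveLinearMap.mk₀ Λ₀ fun f hf => by
    have h1 : 0 ≤ cfcHom hA (f : C(spectrum ℝ A, ℝ)) := (cfcHom_nonneg_iff hA).2 hf
    exact ((ContinuousLinearMap.nonneg_iff_isPositive _).1 h1).re_inner_nonneg_right e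
  have hK : IsCompact (spectrum ℝ A) := isCompact_iff_compactSpace.2 inferInstance
  let ν := RealRMK.rieszMeasure Λ
  refine ⟨ν.map Subtype.val, inferInstance, ⟨spectrum ℝ A, hK, ?_⟩, fun p => ?_⟩
  · rw [Measure.map_apply measurable_subtype_coe hK.measurableSet.compl]
    simp
  · rw [integral_map measurable_subtype_coe.aemeasurable
      p.continuous.aestronglyMeasurable]
    -- The spectrum is compact, so the restriction of `p` to it counts as a compactly supported
    -- function.
    have h := RealRMK.integral_rieszMeasure Λ
      (CompactlySupportedContinuousMap.continuousMapEquiv (p.toContinuousMapOn (spectrum ℝ A)))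
    refine h.trans ?_
    change (inner ℂ e (cfcHom hA (p.toContinuousMapOn (spectrum ℝ A)) e)).re = _
    rw [← cfc_polynomial p A hA, cfc_apply p.eval A hA p.continuous.continuousOn]
    rfl

theorem integrable_of_compact_support {μ : Measure ℝ} [IsFiniteMeasure μ] {K : Set ℝ}
    (hK : IsCompact K) (h : μ Kᶜ = 0) {f : ℝ → ℝ} (hf : Continuous f) : Integrable f μ := by
  have : μ.restrict K = μ := Measure.restrict_eq_self_of_ae_mem (mem_ae_iff.2 h)
  rw [← this]
  exact hf.continuousOn.integrableOn_compact hK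

/-- Markov's inequality for `y^(2n)` bounds the mass of `ν` outside the interval by `(R/(R+1))^(2n)
μ(ℝ)`, which tends to 0. -/
theorem measure_compl_Icc_eq_zero_of_moments_eq {μ ν : Measure ℝ} [IsFiniteMeasure μ]
    [IsFiniteMeasure ν] {R : ℝ} (hR : 0 ≤ R) (hμ : μ (Set.Icc (-R) R)ᶜ = 0)
    (hν : ∀ n : ℕ, Integrable (fun y : ℝ => y ^ n) ν)
    (h : ∀ n : ℕ, ∫ y, y ^ n ∂ν = ∫ y, y ^ n ∂μ) :
    ν (Set.Icc (-(R + 1)) (R + 1))ᶜ = 0 := by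
  have hbound : ∀ n : ℕ, ν.real (Set.Icc (-(R + 1)) (R + 1))ᶜ
      ≤ ((R / (R + 1)) ^ 2) ^ n * μ.real Set.univ := by
    intro n
    have h1 := mul_meas_ge_le_integral_of_nonneg (μ := ν) (f := fun y => y ^ (2 * n))
      (Filter.Eventually.of_forall fun y => by simp [pow_mul, pow_nonneg, sq_nonneg]) (hν (2 * n))
      ((R + 1) ^ (2 * n))
    have h2 : ∫ y, y ^ (2 * n) ∂μ ≤ R ^ (2 * n) * μ.real Set.univ := by
      refine (integral_mono_ae (integrable_of_compact_support isCompact_Icc hμ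
        (continuous_pow _)) (integrable_const (R ^ (2 * n))) ?_).trans_eq ?_
      · filter_upwards [mem_ae_iff.2 hμ] with y hy
        simp only [pow_mul]
        exact pow_le_pow_left₀ (sq_nonneg y) (sq_le_sq' hy.1 hy.2) n
      · simp [mul_comm]
    have h3 : ν.real (Set.Icc (-(R + 1)) (R + 1))ᶜ
        ≤ ν.real {y : ℝ | (R + 1) ^ (2 * n) ≤ y ^ (2 * n)} := by
      refine measureReal_mono fun y hy => ?_
      have hy' : R + 1 ≤ |y| := by
        by_contra hlt
        exact hy (abs_le.1 (not_le.1 hlt).le)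
      simp only [Set.mem_ofPred_eq, pow_mul]
      rw [← sq_abs y]
      gcongr
    rw [← pow_mul, div_pow, div_mul_eq_mul_div, le_div_iff₀ (by positivity), mul_comm]
    rw [h] at h1
    exact (mul_le_mul_of_nonneg_left h3 (by positivity)).trans (h1.trans h2)
  have hlim : Filter.Tendsto (fun n : ℕ => ((R / (R + 1)) ^ 2) ^ n * μ.real Set.univ)
      Filter.atTop (nhds (0 * μ.real Set.univ)) := by
    refine (tendsto_pow_atTop_nhds_zero_of_lt_one (sq_nonneg _) ?_).mul_const _
    exact pow_lt_one₀ (by positivity) ((div_lt_one (by positivity)).2 (by linarith)) two_ne_zero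
  rw [zero_mul] at hlim
  have h0 := ge_of_tendsto' hlim hbound
  exact (measureReal_eq_zero_iff).1 (le_antisymm h0 measureReal_nonneg)

theorem abs_integral_sub_le_of_near {μ : Measure ℝ} [IsFiniteMeasure μ] {R ε : ℝ} {f g : ℝ → ℝ}
    (hμ : μ (Set.Icc (-R) R)ᶜ = 0) (hf : Continuous f) (hg : Continuous g)
    (hfg : ∀ y ∈ Set.Icc (-R) R, |g y - f y| < ε) :
    |∫ y, g y ∂μ - ∫ y, f y ∂μ| ≤ ε * μ.real Set.univ := by
  rw [← integral_sub (integrable_of_compact_support isCompact_Icc hμ hg)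
    (integrable_of_compact_support isCompact_Icc hμ hf), ← Real.norm_eq_abs]
  refine norm_integral_le_of_norm_le_const ?_
  filter_upwards [mem_ae_iff.2 hμ] with y hy
  exact (hfg y hy).le

theorem integral_eval_eq_of_moments_eq {μ ν : Measure ℝ}
    (hμ : ∀ n : ℕ, Integrable (fun y : ℝ => y ^ n) μ)
    (hν : ∀ n : ℕ, Integrable (fun y : ℝ => y ^ n) ν)
    (h : ∀ n : ℕ, ∫ y, y ^ n ∂ν = ∫ y, y ^ n ∂μ) (p : ℝ[X]) :
    ∫ y, p.eval y ∂ν = ∫ y, p.eval y ∂μ := by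
  simp only [eval_eq_sum_range]
  rw [integral_finsetSum _ fun i _ => (hν i).const_mul _,
    integral_finsetSum _ fun i _ => (hμ i).const_mul _]
  simp only [integral_const_mul, h]

/-- A compactly supported measure on the line is determined by its moments. -/
theorem measure_eq_of_moments_eq {μ ν : Measure ℝ} [IsFiniteMeasure μ] [IsFiniteMeasure ν]
    {K : Set ℝ} (hK : IsCompact K) (hμK : μ Kᶜ = 0)
    (hν : ∀ n : ℕ, Integrable (fun y : ℝ => y ^ n) ν)
    (h : ∀ n : ℕ, ∫ y, y ^ n ∂ν = ∫ y, y ^ n ∂μ) : ν = μ := by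
  obtain ⟨r, hr⟩ := hK.isBounded.subset_closedBall 0
  set R := max r 0
  have hKR : K ⊆ Set.Icc (-R) R := fun y hy => by
    have := hr hy
    rw [Metric.mem_closedBall, dist_zero_right, Real.norm_eq_abs] at this
    exact abs_le.1 (this.trans (le_max_left _ _))
  have hμR : μ (Set.Icc (-R) R)ᶜ = 0 := measure_mono_null (Set.compl_subset_compl.2 hKR) hμK
  have hνS := measure_compl_Icc_eq_zero_of_moments_eq (le_max_right _ _) hμR hν h
  have hμS : μ (Set.Icc (-(R + 1)) (R + 1))ᶜ = 0 :=
    measure_mono_null (Set.compl_subset_compl.2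
      (Set.Icc_subset_Icc (by linarith) (by linarith))) hμR
  have hμi : ∀ n : ℕ, Integrable (fun y : ℝ => y ^ n) μ := fun n =>
    integrable_of_compact_support hK hμK (continuous_pow n)
  refine ext_of_forall_integral_eq_of_IsFiniteMeasure fun f => ?_
  rw [← sub_eq_zero, ← abs_eq_zero]
  set M := ν.real Set.univ + μ.real Set.univ
  have hM : 0 ≤ M := by positivity
  refine le_antisymm (le_of_forall_pos_le_add fun ε hε => ?_) (abs_nonneg _)
  -- Weierstrass on an interval carrying both measures. The two errors add up to at most `ε
  -- M/(M+1)`, and the `+ 1` covers `M = 0`.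
  obtain ⟨p, hp⟩ := exists_polynomial_near_of_continuousOn (-(R + 1)) (R + 1) f
    f.continuous.continuousOn (ε / (M + 1)) (by positivity)
  have h1 := abs_integral_sub_le_of_near hνS f.continuous p.continuous hp
  have h2 := abs_integral_sub_le_of_near hμS f.continuous p.continuous hp
  rw [integral_eval_eq_of_moments_eq hμi hν h] at h1
  rw [abs_sub_comm] at h1
  calc |∫ y, f y ∂ν - ∫ y, f y ∂μ|
      ≤ |∫ y, f y ∂ν - ∫ y, p.eval y ∂μ| + |∫ y, p.eval y ∂μ - ∫ y, f y ∂μ| :=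
        abs_sub_le _ _ _
    _ ≤ ε / (M + 1) * M := (add_le_add h1 h2).trans_eq (mul_add _ _ _).symm
    _ ≤ 0 + ε := by
        rw [zero_add, div_mul_eq_mul_div, div_le_iff₀ (by positivity)]
        nlinarith

/-! ### Jacobi operators on the space of square-summable sequences -/

/-- The Hilbert space of square-summable sequences. -/
abbrev SeqL2 : Type := lp (fun _ : ℕ => ℂ) 2

/-- Injectivity of `s` gives `∑ |f (s n)|² ≤ ∑ |f n|²`. The case `s = id` is a diagonal operator, `s
= succ` a weighted backward shift. -/
theorem exists_weighted_comp {w : ℕ → ℝ} {C : ℝ} (hw : ∀ n, |w n| ≤ C) {s : ℕ → ℕ}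
    (hs : Function.Injective s) :
    ∃ A : SeqL2 →L[ℂ] SeqL2, ∀ (f : SeqL2) (n : ℕ), A f n = w n * f (s n) := by
  have hC : 0 ≤ C := (abs_nonneg _).trans (hw 0)
  have hle : ∀ (f : SeqL2) (n : ℕ),
      ‖(w n : ℂ) * f (s n)‖ ^ (2 : ℝ) ≤ C ^ (2 : ℝ) * ‖f (s n)‖ ^ (2 : ℝ) := fun f n => by
    rw [norm_mul, Complex.norm_real, Real.norm_eq_abs,
      Real.mul_rpow (abs_nonneg _) (norm_nonneg _)]
    gcongr
    exact hw n
  have hsum : ∀ f : SeqL2, Summable fun n => ‖f n‖ ^ (2 : ℝ) := fun f => by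
    simpa using (lp.memℓp f).summable (by norm_num)
  have hsum' : ∀ f : SeqL2, Summable fun n => C ^ (2 : ℝ) * ‖f (s n)‖ ^ (2 : ℝ) := fun f =>
    ((hsum f).comp_injective hs).mul_left _
  have hmem : ∀ f : SeqL2, Memℓp (fun n => (w n : ℂ) * f (s n)) 2 := fun f => by
    refine memℓp_gen ?_
    simpa using Summable.of_nonneg_of_le (fun n => by positivity) (hle f) (hsum' f)
  let A₀ : SeqL2 →ₗ[ℂ] SeqL2 :=
    { toFun := fun f => ⟨fun n => (w n : ℂ) * f (s n), hmem f⟩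
      map_add' := fun f g => by ext n; exact mul_add _ _ _
      map_smul' := fun c f => by ext n; exact mul_left_comm _ _ _ }
  refine ⟨A₀.mkContinuous C fun f => ?_, fun f n => rfl⟩
  refine lp.norm_le_of_tsum_le (by norm_num) (by positivity) ?_
  have hnorm := lp.norm_rpow_eq_tsum (p := 2) (by norm_num) f
  rw [Real.mul_rpow hC (norm_nonneg _), hnorm]
  simp only [ENNReal.toReal_ofNat]
  refine (Summable.tsum_le_tsum (hle f)
    (Summable.of_nonneg_of_le (fun n => by positivity) (hle f) (hsum' f)) (hsum' f)).trans ?_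
  rw [tsum_mul_left]
  exact mul_le_mul_of_nonneg_left
    (tsum_comp_le_tsum_of_inj (hsum f) (fun n => by positivity) hs) (by positivity)

/-- A bounded Jacobi matrix is the matrix of a bounded self-adjoint operator. -/
theorem exists_jacobi {a b : ℕ → ℝ} {Ca Cb : ℝ} (ha : ∀ n, |a n| ≤ Ca) (hb : ∀ n, |b n| ≤ Cb) :
    ∃ A : SeqL2 →L[ℂ] SeqL2, IsSelfAdjoint A ∧
      A (lp.single 2 0 1) = (a 0 : ℂ) • lp.single 2 0 1 + (b 0 : ℂ) • lp.single 2 1 1 ∧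
      ∀ n, A (lp.single 2 (n + 1) 1) = (b n : ℂ) • lp.single 2 n 1
        + (a (n + 1) : ℂ) • lp.single 2 (n + 1) 1
        + (b (n + 1) : ℂ) • lp.single 2 (n + 2) 1 := by
  obtain ⟨D, hD⟩ := exists_weighted_comp ha Function.injective_id
  obtain ⟨S, hS⟩ := exists_weighted_comp hb Nat.succ_injective
  have hDs : IsSelfAdjoint D := by
    rw [ContinuousLinearMap.isSelfAdjoint_iff_isSymmetric]
    intro f g
    simp only [ContinuousLinearMap.coe_coe, lp.inner_eq_tsum, hD]
    refine tsum_congr fun n => ?_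
    simp
    ring
  -- The adjoint of the backward shift sends `eₙ` to `bₙ eₙ₊₁`; its coordinates are found by pairing
  -- with basis vectors.
  have hadj : ∀ n k : ℕ, (ContinuousLinearMap.adjoint S (lp.single 2 n 1) : SeqL2) k
      = (b n : ℂ) * (lp.single 2 (n + 1) 1 : SeqL2) k := by
    intro n k
    have h1 := lp.inner_single_left (𝕜 := ℂ) k (1 : ℂ)
      (ContinuousLinearMap.adjoint S (lp.single 2 n 1))
    rw [ContinuousLinearMap.adjoint_inner_right, lp.inner_single_right, hS] at h1
    simp only [RCLike.inner_apply, map_one, mul_one, one_mul, map_mul, Complex.conj_ofReal] at h1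
    rw [← h1]
    by_cases hk : k = n + 1
    · subst hk; simp
    · simp [lp.single_apply, hk, Ne.symm hk]
  refine ⟨D + S + ContinuousLinearMap.adjoint S, ?_, ?_, fun n => ?_⟩
  · rw [add_assoc]
    exact hDs.add (IsSelfAdjoint.add_star_self S)
  · ext k
    simp only [_root_.add_apply, lp.coeFn_add, Pi.add_apply, hD, hS, hadj,
      lp.coeFn_smul, Pi.smul_apply, smul_eq_mul]
    by_cases hk : k = 0 <;> simp [lp.single_apply, Pi.single_apply, hk]
  · ext k
    simp only [_root_.add_apply, lp.coeFn_add, Pi.add_apply, hD, hS, hadj,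
      lp.coeFn_smul, Pi.smul_apply, smul_eq_mul]
    simp only [lp.single_apply, Pi.single_apply, id]
    have : k.succ = n + 1 ↔ k = n := by omega
    simp only [this]
    by_cases h0 : k = n
    · subst h0; simp; omega
    by_cases h1 : k = n + 1
    · subst h1; simp
    by_cases h2 : k = n + 2
    · subst h2; simp
    simp [h0, h1, h2]

/-! ### The orthogonality measure -/

theorem exists_poisson_operator {q t : ℝ} (hqt : |q| < t) (ht : t < 1) :
    ∃ (A : SeqL2 →L[ℂ] SeqL2) (v : ℕ → SeqL2), IsSelfAdjoint A ∧ ‖v 0‖ = 1 ∧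
      (∀ m n, m ≠ n → inner ℂ (v m) (v n) = 0) ∧
      ∀ n, aeval A (poissonPoly q t n) (v 0) = v n := by
  have hC : 0 ≤ (1 - t)⁻¹ := (abs_nonneg _).trans (abs_qtNumber_le hqt ht 0)
  have hs : ∀ n, |√(qtNumber q t (n + 1))| ≤ √(1 - t)⁻¹ := fun n => by
    rw [abs_of_nonneg (Real.sqrt_nonneg _)]
    exact Real.sqrt_le_sqrt ((le_abs_self _).trans (abs_qtNumber_le hqt ht _))
  obtain ⟨A, hA, hA0, hA1⟩ := exists_jacobi (abs_qtNumber_le hqt ht) hs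
  -- The Jacobi matrix is symmetric while the `Pₙ` are monic. Rescaling `eₙ` by `√[1]⋯√[n]` turns
  -- the symmetric recursion into the monic one.
  let c : ℕ → ℝ := fun n => ∏ i ∈ Finset.range n, √(qtNumber q t (i + 1))
  have hc : ∀ n, c (n + 1) = c n * √(qtNumber q t (n + 1)) := fun n => Finset.prod_range_succ _ _
  let v : ℕ → SeqL2 := fun n => (c n : ℂ) • lp.single 2 n 1
  have hv0 : v 0 = lp.single 2 0 1 := by simp [v, c]
  refine ⟨A, v, hA, ?_, fun m n hmn => ?_, fun n => ?_⟩
  · rw [hv0, lp.norm_single (by norm_num)]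
    simp
  · simp only [v, inner_smul_left, inner_smul_right, lp.inner_single_left]
    simp [lp.single_apply, hmn]
  · have key := aeval_poissonPoly_apply q t (A : Module.End ℂ SeqL2) v ?_ ?_ n
    -- `key` concerns plain linear endomorphisms; the forgetful ring homomorphism carries it back to
    -- bounded operators.
    · rw [← key, Polynomial.aeval_map_algebraMap]
      have h := Polynomial.map_aeval_eq_aeval_map
        (R := ℝ) (S := SeqL2 →L[ℂ] SeqL2) (T := ℝ) (U := Module.End ℂ SeqL2)
        (φ := RingHom.id ℝ) (ψ := ContinuousLinearMap.toLinearMapRingHom) ?_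
        (poissonPoly q t n) A
      · rw [Polynomial.map_id] at h
        exact congrArg (fun B : Module.End ℂ SeqL2 => B (v 0)) h
      · ext r w
        rfl
    · change A (v 0) = v 1
      rw [hv0, hA0]
      simp [v, c, qtNumber_zero]
    · intro n
      change A (v (n + 1)) = _
      have hsq : (√(qtNumber q t (n + 1)) : ℂ) * √(qtNumber q t (n + 1))
          = qtNumber q t (n + 1) := by
        rw [← Complex.ofReal_mul, Real.mul_self_sqrt (qtNumber_pos hqt n).le]
      simp only [v, map_smul, hA1, smul_add, smul_smul, hc, Complex.ofReal_mul]
      rw [mul_assoc (c n : ℂ), hsq, mul_comm (qtNumber q t (n + 1) : ℂ) (c n : ℂ),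
        mul_comm (qtNumber q t (n + 1) : ℂ)]
      abel

theorem isSelfAdjoint_aeval {E : Type*} [NormedAddCommGroup E] [InnerProductSpace ℂ E]
    [CompleteSpace E] {A : E →L[ℂ] E} (hA : IsSelfAdjoint A) (p : ℝ[X]) :
    IsSelfAdjoint (aeval A p) := by
  rw [← cfc_polynomial p A hA]
  exact cfc_predicate _ A

/-- Self-adjointness of `P_m(A)` turns `∫ P_m P_n` into `Re ⟪P_m(A) v₀, P_n(A) v₀⟫ = Re ⟪v_m, v_n⟫`.
The total mass is `‖v₀‖² = 1`. -/
theorem exists_orthogonalityMeasure_of_operator {E : Type*} [NormedAddCommGroup E]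
    [InnerProductSpace ℂ E] [CompleteSpace E] {q t : ℝ} {A : E →L[ℂ] E} (hA : IsSelfAdjoint A)
    {v : ℕ → E} (hv0 : ‖v 0‖ = 1) (hv : ∀ m n, m ≠ n → inner ℂ (v m) (v n) = 0)
    (hAv : ∀ n, aeval A (poissonPoly q t n) (v 0) = v n) :
    ∃ μ : Measure ℝ, IsOrthogonalityMeasure (poissonPoly q t) μ ∧
      ∃ K : Set ℝ, IsCompact K ∧ μ Kᶜ = 0 := by
  obtain ⟨μ, hμ, ⟨K, hK, hμK⟩, hint⟩ := exists_spectral_measure A hA (v 0)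
  refine ⟨μ, ⟨?_, fun n => integrable_of_compact_support hK hμK (continuous_pow n),
    fun m n hmn => ?_⟩, K, hK, hμK⟩
  · have h1 := hint 1
    simp only [eval_one, integral_const, smul_eq_mul, mul_one, map_one,
      one_apply_eq_self] at h1
    rw [inner_self_eq_norm_sq_to_K, hv0] at h1
    exact ⟨by simpa [measureReal_def, ENNReal.toReal_eq_one_iff] using h1⟩
  · have h1 := hint (poissonPoly q t m * poissonPoly q t n)
    simp only [eval_mul] at h1
    have hsa := isSelfAdjoint_aeval hA (poissonPoly q t m)
    have hsym := (ContinuousLinearMap.isSelfAdjoint_iff_isSymmetric.1 hsa) (v 0)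
      (aeval A (poissonPoly q t n) (v 0))
    rw [h1, map_mul, mul_apply_eq_comp]
    simp only [ContinuousLinearMap.coe_coe] at hsym
    rw [← hsym, hAv, hAv, hv m n hmn, Complex.zero_re]

theorem exists_poisson_measure {q t : ℝ} (hqt : |q| < t) (ht : t < 1) :
    ∃ μ : Measure ℝ, IsOrthogonalityMeasure (poissonPoly q t) μ ∧
      ∃ K : Set ℝ, IsCompact K ∧ μ Kᶜ = 0 := by
  obtain ⟨A, v, hA, hv0, hv, hAv⟩ := exists_poisson_operator hqt ht
  exact exists_orthogonalityMeasure_of_operator hA hv0 hv hAv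

theorem integrable_eval {μ : Measure ℝ} (hμ : ∀ n : ℕ, Integrable (fun y : ℝ => y ^ n) μ)
    (p : ℝ[X]) : Integrable (fun y => p.eval y) μ := by
  simp only [eval_eq_sum_range]
  exact integrable_finsetSum _ fun i _ => (hμ i).const_mul _

/-- Integration of polynomials, as a linear functional. -/
def integralFunctional {μ : Measure ℝ} (hμ : ∀ n : ℕ, Integrable (fun y : ℝ => y ^ n) μ) :
    ℝ[X] →ₗ[ℝ] ℂ where
  toFun p := ((∫ y, p.eval y ∂μ : ℝ) : ℂ)
  map_add' p r := by
    simp only [eval_add]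
    rw [integral_add (integrable_eval hμ p) (integrable_eval hμ r), Complex.ofReal_add]
  map_smul' c p := by simp [integral_const_mul]

/-- Orthogonality to `P₀ = 1` says that `∫ Pₙ = 0` for `n ≥ 1`, so both functionals agree on a
spanning set. This serves for the vacuum functional and for a second orthogonality measure. -/
theorem linearMap_eq_integral {q t : ℝ} {μ : Measure ℝ}
    (hμ : IsOrthogonalityMeasure (poissonPoly q t) μ) (f : ℝ[X] →ₗ[ℝ] ℂ)
    (h0 : f (poissonPoly q t 0) = 1) (h : ∀ n, f (poissonPoly q t (n + 1)) = 0) (p : ℝ[X]) :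
    f p = ((∫ y, p.eval y ∂μ : ℝ) : ℂ) := by
  have := hμ.isProbabilityMeasure
  suffices f = integralFunctional hμ.integrable_pow from congrArg (· p) this
  refine linearMap_ext_poissonPoly q t fun n => ?_
  cases n with
  | zero => rw [h0]; simp [integralFunctional, poissonPoly]
  | succ n =>
    have := hμ.orthogonal 0 (n + 1) (by omega)
    rw [h]
    simp [poissonPoly] at this
    simp [integralFunctional, this]

theorem IsOrthogonalityMeasure.moments_eq {q t : ℝ} {μ ν : Measure ℝ}
    (hμ : IsOrthogonalityMeasure (poissonPoly q t) μ)
    (hν : IsOrthogonalityMeasure (poissonPoly q t) ν) (n : ℕ) :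
    ∫ y, y ^ n ∂ν = ∫ y, y ^ n ∂μ := by
  have := hν.isProbabilityMeasure
  have h := linearMap_eq_integral hμ (integralFunctional hν.integrable_pow) (by simp [integralFunctional, poissonPoly]) (fun n => by
    have h1 := hν.orthogonal 0 (n + 1) (by omega)
    simp only [poissonPoly, eval_one, one_mul] at h1
    simp [integralFunctional, h1]) (X ^ n)
  simpa [integralFunctional] using h

/-! ### The vacuum distribution of the field operator -/

variable {H : Type*} [NormedAddCommGroup H] [InnerProductSpace ℂ H]

theorem creation_pureTensor_const (x : H) (n : ℕ) :
    creation x (pureTensor fun _ : Fin n => x) = pureTensor fun _ : Fin (n + 1) => x := by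
  rw [creation_pureTensor]
  congr 1
  ext i
  refine Fin.lastCases ?_ (fun j => ?_) i <;> simp

theorem fieldOp_vacuum (q t : ℝ) (T : H → (H →L[ℂ] H)) (x : H) :
    fieldOp q t T x (pureTensor fun _ : Fin 0 => x) = pureTensor fun _ : Fin 1 => x := by
  have h : (pureTensor fun _ : Fin 0 => x) = vacuum H := by
    rw [vacuum]; congr 1; ext i; exact i.elim0
  rw [fieldOp, LinearMap.add_apply, LinearMap.add_apply, creation_pureTensor_const, h,
    annihilation_vacuum, gauge_vacuum, zero_add, add_zero]

/-- With all factors equal, every deletion gives the same tensor, and the gauge term with `T x = Id`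
restores the lost factor. So annihilation and gauge both contribute the total weight `∑ t^k q^(n-k)
= [n+1]`. -/
theorem fieldOp_pureTensor_const (q t : ℝ) {T : H → (H →L[ℂ] H)} {x : H} (hx : ‖x‖ = 1)
    (hT : T x = ContinuousLinearMap.id ℂ H) (n : ℕ) :
    fieldOp q t T x (pureTensor fun _ : Fin (n + 1) => x) =
      (pureTensor fun _ : Fin (n + 2) => x)
        + (qtNumber q t (n + 1) : ℂ) • (pureTensor fun _ : Fin (n + 1) => x)
        + (qtNumber q t (n + 1) : ℂ) • (pureTensor fun _ : Fin n => x) := by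
  have hsnoc : (Fin.snoc (α := fun _ => H) (fun _ : Fin n => x) x) = fun _ => x := by
    ext i
    refine Fin.lastCases ?_ (fun j => ?_) i <;> simp
  have hrem : ∀ k : Fin (n + 1), k.removeNth (fun _ : Fin (n + 1) => x) = fun _ => x :=
    fun k => rfl
  have hxx : inner ℂ x x = (1 : ℂ) := by rw [inner_self_eq_norm_sq_to_K, hx]; simp
  rw [fieldOp, LinearMap.add_apply, LinearMap.add_apply, creation_pureTensor_const, hT,
    annihilation_pureTensor, gauge_pureTensor]
  simp only [hrem, hxx, mul_one, ContinuousLinearMap.id_apply, hsnoc, ← Finset.sum_smul]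
  rw [qtNumber_succ_eq_sum_fin]
  push_cast
  abel

/-- The vacuum functional `p ↦ ⟪Ω, p(X) Ω⟫` on real polynomials. -/
def vacuumFunctional (q t : ℝ) (Y : Module.End ℂ (Fock H)) : ℝ[X] →ₗ[ℝ] ℂ where
  toFun p := vacuumState q t (aeval Y (p.map (algebraMap ℝ ℂ)))
  map_add' p r := by simp [vacuumState, qtInner]
  map_smul' c p := by
    rw [Polynomial.map_smul, map_smul]
    simp [vacuumState, qtInner]

theorem vacuumState_fieldOp_pow {q t : ℝ} {T : H → (H →L[ℂ] H)} {x : H} (hx : ‖x‖ = 1)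
    (hT : T x = ContinuousLinearMap.id ℂ H) {μ : Measure ℝ}
    (hμ : IsOrthogonalityMeasure (poissonPoly q t) μ) (n : ℕ) :
    vacuumState q t (fieldOp q t T x ^ n) = ((∫ y, y ^ n ∂μ : ℝ) : ℂ) := by
  have hvac : vacuum H = pureTensor fun _ : Fin 0 => x := by
    rw [vacuum]; congr 1; ext i; exact i.elim0
  have hP : ∀ n, vacuumFunctional q t (fieldOp q t T x) (poissonPoly q t n)
      = qtInner q t (pureTensor fun _ : Fin 0 => x) (pureTensor fun _ : Fin n => x) := fun n => by
    have h := aeval_poissonPoly_apply q t (fieldOp q t T x)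
      (fun n => pureTensor fun _ : Fin n => x) (fieldOp_vacuum q t T x)
      (fieldOp_pureTensor_const q t hx hT) n
    rw [← h, ← hvac]
    rfl
  have h := linearMap_eq_integral hμ (vacuumFunctional q t (fieldOp q t T x))
    (by rw [hP, qtInner_pureTensor]; simp [inversions])
    (fun n => by rw [hP, qtInner_pureTensor_of_ne _ _ (by omega)]) (X ^ n)
  simpa [vacuumFunctional] using h

end QTFock

end

theorem mainTheorem8 {H : Type*} [NormedAddCommGroup H] [InnerProductSpace ℂ H] [CompleteSpace H]
    (q t : ℝ) (hqt : |q| < t) (ht : t < 1)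
    (T : H → (H →L[ℂ] H)) (x : H) (hx : ‖x‖ = 1) (hT : T x = ContinuousLinearMap.id ℂ H) :
    ∃ μ : MeasureTheory.Measure ℝ,
      (∀ ν : MeasureTheory.Measure ℝ,
        QTFock.IsOrthogonalityMeasure (QTFock.poissonPoly q t) ν ↔ ν = μ) ∧
      (∀ ν : MeasureTheory.Measure ℝ,
        QTFock.IsDistribution (QTFock.vacuumState (H := H) q t) (QTFock.fieldOp q t T x) ν ↔
          ν = μ) := by
  obtain ⟨μ, hμ, K, hK, hμK⟩ := QTFock.exists_poisson_measure hqt ht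
  have hμp := hμ.isProbabilityMeasure
  have hmom := QTFock.vacuumState_fieldOp_pow (q := q) (t := t) hx hT hμ
  refine ⟨μ, fun ν => ⟨fun hν => ?_, fun h => h ▸ hμ⟩, fun ν => ⟨fun hν => ?_, fun h => ?_⟩⟩
  -- Here `ν` has only finite moments; compact support comes from `μ`.
  · have hνp := hν.isProbabilityMeasure
    exact QTFock.measure_eq_of_moments_eq hK hμK hν.integrable_pow (hμ.moments_eq hν)
  · have hνp := hν.isProbabilityMeasure
    obtain ⟨K', hK', hνK'⟩ := hν.compact_support
    refine QTFock.measure_eq_of_moments_eq hK hμK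
      (fun n => QTFock.integrable_of_compact_support hK' hνK' (continuous_pow n)) fun n => ?_
    have h := hν.moment_eq n
    rw [hmom n] at h
    exact_mod_cast h.symm
  · exact h ▸ ⟨hμp, ⟨K, hK, hμK⟩, hmom⟩
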